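/- Let $G$ be a finite multigraph with open edges, with vertex set $V$, edge set $E$, and finite sets $S$, $T$ of open ends of its input and output edges. Every edge has two ends, each attached to a vertex or equal to an element of $S\cup T$; every element of $S\cup T$ is the end of exactly one edge, and no edge joins two elements of $S$ or two elements of $T$ (parallel edges, loops, and edges joining $S$ directly to $T$ are allowed; $G$ need not be connected). Assume that every vertex has degree $d$, and let $O$ be an ordering, i.e. a choice, for every $v\in V$, of a bijection from $\{1,\dots,d\}$ to the edge ends attached to $v$; write $e_a(v)$ for the edge containing the $a$-th of them. For $N\ge 1$ and a tensor $\mathcal T\in(\mathbb C^N)^{\otimes d}$ let $L=L(\mathcal T)\colon(\mathbb C^N)^{\otimes S}\to(\mathbb C^N)^{\otimes T}$ be the linear operator obtained by placing the same tensor $\mathcal T$ at every vertex and contracting the network, $$L_{y,x}=\sum_{i}\ \prod_{v\in V}\mathcal T_{i(e_1(v)),\dots,i(e_d(v))},$$ where the sum is over all $i\colon E\to\{1,\dots,N\}$ that agree with $x$ on the input edges and with $y$ on the output edges. Let $QMF(G,N,O)=\max_{\mathcal T}\operatorname{rank}L(\mathcal T)$. A cut is a partition of $V\cup S\cup T$ into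 $\overline S\supseteq S$ and $\overline T\supseteq T$; its cut set consists of the edges with one end in $\overline S$ and one end in $\overline T$. Let $MC(G)$ be the minimal number of edges in a cut set, and let $QMC(G,N)=N^{MC(G)}$ be the minimum over all cuts of the product of the capacities of the edges in the cut set, when every edge has capacity $N$. **Theorem.** For all $G$ and $O$, as $N\to\infty$, $$QMF(G,N,O)=\Theta\bigl(QMC(G,N)\bigr).$$ Moreover, there is a constant $c>0$ depending only on $G$ such that $QMF(G,N,O)\ge c\,N^{MC(G)}$ for all orderings $O$ and all $N\ge 1$. -/

import Mathlib

open scoped Asymptotics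

namespace TensorNet

/-- The points at which an edge of an open graph can end: a vertex of the graph, the open end of an
input edge, or the open end of an output edge.  -/
inductive Node (V S T : Type*)
  | vertex (v : V) : Node V S T
  | input (s : S) : Node V S T
  | output (t : T) : Node V S T

/-- A multigraph with open edges: `V` is the set of vertices, `E` the set of edges, `S` and `T` are
the sets of open ends of the input edges and of the output edges. Every edge `e` has two ends,
`ends e false` and `ends e true` (the labels carry no meaning). Parallel edges and loops are
allowed, as are edges joining an input directly to an output. -/
structure OpenGraph (V S T E : Type*) where
  /-- The two ends of each edge. -/
  ends : E → Bool → Node V S T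
  /-- Every input end is the end of exactly one edge. -/
  input_unique : ∀ s : S, ∃! h : E × Bool, ends h.1 h.2 = Node.input s
  /-- Every output end is the end of exactly one edge. -/
  output_unique : ∀ t : T, ∃! h : E × Bool, ends h.1 h.2 = Node.output t
  /-- No edge joins two input ends. -/
  not_input_input : ∀ e s s', ¬ (ends e false = Node.input s ∧ ends e true = Node.input s')
  /-- No edge joins two output ends. -/
  not_output_output : ∀ e t t', ¬ (ends e false = Node.output t ∧ ends e true = Node.output t')

namespace OpenGraph

variable {V S T E : Type*} (G : OpenGraph V S T E)

/-- The ends of edges that are attached to the vertex `v`. -/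
abbrev EndsAt (v : V) : Type _ := {h : E × Bool // G.ends h.1 h.2 = Node.vertex v}

/-- A local ordering: at each vertex, a bijection between the `d` indices of the tensor and the
ends of edges attached to that vertex. It exists exactly when all vertices have degree `d`
(a loop counts twice). -/
abbrev LocalOrdering (d : ℕ) : Type _ := ∀ v : V, Fin d ≃ G.EndsAt v

/-- The assignment `i` of indices to the edges takes the values `x` on the input edges and `y` on
the output edges. -/
def Compatible {N : ℕ} (x : S → Fin N) (y : T → Fin N) (i : E → Fin N) : Prop :=
  (∀ e b s, G.ends e b = Node.input s → i e = x s) ∧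
    (∀ e b t, G.ends e b = Node.output t → i e = y t)

open Classical in
/-- The linear operator `L` obtained by placing the same tensor `𝒯` at every vertex and contracting
the network, as a matrix from `⨂_S ℂ^N` to `⨂_T ℂ^N`. -/
noncomputable def contraction [Fintype V] [Fintype E] {d : ℕ} (O : G.LocalOrdering d) {N : ℕ}
    (𝒯 : (Fin d → Fin N) → ℂ) : Matrix (T → Fin N) (S → Fin N) ℂ :=
  Matrix.of fun y x =>
    ∑ i : E → Fin N with G.Compatible x y i, ∏ v : V, 𝒯 (fun a => i (O v a).1.1)

/-- The quantum max-flow `QMF(G, N, O)`: the maximal rank of `L` over all tensors `𝒯`. (The ranks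
are bounded by `N ^ |S|`, so the supremum is a maximum.) -/
noncomputable def quantumMaxFlow [Fintype V] [Fintype S] [DecidableEq S] [Fintype E] {d : ℕ}
    (O : G.LocalOrdering d) (N : ℕ) : ℕ :=
  ⨆ 𝒯 : (Fin d → Fin N) → ℂ, (G.contraction O 𝒯).rank

end OpenGraph

/-- A cut separating `S` from `T`, given by its side `A` that contains all of `S` and none of `T`
(the other side is the complement of `A`). -/
def IsCut {V S T : Type*} (A : Set (Node V S T)) : Prop :=
  (∀ s, Node.input s ∈ A) ∧ (∀ t, Node.output t ∉ A)

namespace OpenGraph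

variable {V S T E : Type*} (G : OpenGraph V S T E)

open Classical in
/-- The cut set of a cut: the edges with one end in `A` and the other one outside. -/
noncomputable def cutSet [Fintype E] (A : Set (Node V S T)) : Finset E :=
  {e : E | ∃ b : Bool, G.ends e b ∈ A ∧ G.ends e (!b) ∉ A}

/-- The quantum min-cut `QMC(G, N)`: the minimum over all cuts of the product of the capacities of
the edges in the cut set, every capacity being `N`. -/
noncomputable def quantumMinCut [Fintype E] (N : ℕ) : ℕ :=
  ⨅ A : {A : Set (Node V S T) // IsCut A}, ∏ _e ∈ G.cutSet A.1, N

/-- The min-cut `MC(G)`: the minimum over all cuts of the number of edges in the cut set. -/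
noncomputable def minCut [Fintype E] : ℕ :=
  ⨅ A : {A : Set (Node V S T) // IsCut A}, (G.cutSet A.1).card

end OpenGraph

end TensorNet

/-! Upper bound: across a cut, `L` factors through the assignments of indices to the cut edges, so
its rank is at most `N` to the number of cut edges (`rank_contraction_le_of_isCut`).

Lower bound: when `2 * |E| * n ≤ N`, an index can encode an edge end together with a label in `Fin
n`. Choose `MC(G)` edge-disjoint routes from inputs to outputs (`exists_routing`). The tensor is
built from an indicator: the slots name the edge ends at some single vertex, and labels agree along
the routes through it. Although all vertices share this tensor, the names carried in from the inputs
force each vertex on a route to play its own role. The labels then travel unchanged to the outputs.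
This yields a diagonal submatrix of size `n ^ MC(G)` with nonzero entries
(`card_le_quantumMaxFlow`).

Contraction requires equal indices at the two ends of an edge, whereas the encoding needs the two
end names exchanged. A change of basis by a square root of the exchange permutation
(`exists_symm_sq_eq_of_involutive`) repairs this. Taking `n` proportional to `N` gives the theorem.
-/

namespace TensorNet

/-! ### Edge ends and assignments of values to them. -/

namespace OpenGraph

variable {V S T E : Type*} (G : OpenGraph V S T E)

/-- The edge end equal to the input `s`. -/
noncomputable def inputEnd (s : S) : E × Bool := (G.input_unique s).choose

/-- The edge end equal to the output `t`. -/
noncomputable def outputEnd (t : T) : E × Bool := (G.output_unique t).choose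

theorem ends_inputEnd (s : S) :
    G.ends (G.inputEnd s).1 (G.inputEnd s).2 = Node.input s :=
  (G.input_unique s).choose_spec.1

theorem ends_outputEnd (t : T) :
    G.ends (G.outputEnd t).1 (G.outputEnd t).2 = Node.output t :=
  (G.output_unique t).choose_spec.1

theorem eq_inputEnd {e : E} {b : Bool} {s : S} (h : G.ends e b = Node.input s) :
    (e, b) = G.inputEnd s :=
  (G.input_unique s).choose_spec.2 (e, b) h

theorem eq_outputEnd {e : E} {b : Bool} {t : T} (h : G.ends e b = Node.output t) :
    (e, b) = G.outputEnd t :=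
  (G.output_unique t).choose_spec.2 (e, b) h

theorem compatible_iff {N : ℕ} (x : S → Fin N) (y : T → Fin N) (i : E → Fin N) :
    G.Compatible x y i ↔
      (fun t => i (G.outputEnd t).1) = y ∧ (fun s => i (G.inputEnd s).1) = x := by
  constructor
  · rintro ⟨hx, hy⟩
    exact ⟨funext fun t => hy _ _ _ (G.ends_outputEnd t),
      funext fun s => hx _ _ _ (G.ends_inputEnd s)⟩
  · rintro ⟨rfl, rfl⟩
    refine ⟨fun e b s h => ?_, fun e b t h => ?_⟩
    · simp only [← G.eq_inputEnd h]
    · simp only [← G.eq_outputEnd h]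

variable {G} {d : ℕ} (O : G.LocalOrdering d)

/-- Every edge end is attached to a slot of a vertex, or is an input, or is an output. -/
noncomputable def edgeEndEquiv : (V × Fin d) ⊕ (S ⊕ T) ≃ E × Bool :=
  Equiv.ofBijective
    (Sum.elim (fun p => (O p.1 p.2).1) (Sum.elim G.inputEnd G.outputEnd)) <| by
    constructor
    · have key : ∀ z : (V × Fin d) ⊕ (S ⊕ T),
          (fun h : E × Bool => G.ends h.1 h.2)
            (Sum.elim (fun p => (O p.1 p.2).1) (Sum.elim G.inputEnd G.outputEnd) z) =
          Sum.elim (fun p => Node.vertex p.1) (Sum.elim Node.input Node.output) z := by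
        rintro (⟨v, a⟩ | s | t)
        · exact (O v a).2
        · exact G.ends_inputEnd s
        · exact G.ends_outputEnd t
      intro z z' h
      have hk := key z
      rw [h, key z'] at hk
      rcases z with ⟨v, a⟩ | s | t <;> rcases z' with ⟨v', a'⟩ | s' | t' <;>
        simp only [Sum.elim_inl, Sum.elim_inr, reduceCtorEq, Node.vertex.injEq, Node.input.injEq,
          Node.output.injEq] at hk
      · subst hk
        have : a = a' := (O v').injective (Subtype.ext h)
        rw [this]
      · rw [hk]
      · rw [hk]
    · rintro ⟨e, b⟩
      rcases h : G.ends e b with v | s | t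
      · refine ⟨Sum.inl (v, (O v).symm ⟨(e, b), h⟩), ?_⟩
        simp
      · exact ⟨Sum.inr (Sum.inl s), (G.eq_inputEnd h).symm⟩
      · exact ⟨Sum.inr (Sum.inr t), (G.eq_outputEnd h).symm⟩

/-- The assignment of values to all edge ends that is given by `p` at the vertices, by `x` at the
inputs and by `y` at the outputs. -/
noncomputable def endValue {α : Type*} (p : V → Fin d → α) (x : S → α) (y : T → α) :
    E × Bool → α :=
  fun h => Sum.elim (fun q : V × Fin d => p q.1 q.2) (Sum.elim x y) ((edgeEndEquiv O).symm h)

section endValue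

variable {α : Type*} (p : V → Fin d → α) (x : S → α) (y : T → α)

theorem endValue_edgeEndEquiv (z) : endValue O p x y (edgeEndEquiv O z) =
    Sum.elim (fun q : V × Fin d => p q.1 q.2) (Sum.elim x y) z := by
  simp [endValue]

theorem endValue_vertex (v : V) (a : Fin d) : endValue O p x y (O v a).1 = p v a :=
  endValue_edgeEndEquiv O p x y (Sum.inl (v, a))

theorem endValue_inputEnd (s : S) : endValue O p x y (G.inputEnd s) = x s :=
  endValue_edgeEndEquiv O p x y (Sum.inr (Sum.inl s))

theorem endValue_outputEnd (t : T) : endValue O p x y (G.outputEnd t) = y t :=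
  endValue_edgeEndEquiv O p x y (Sum.inr (Sum.inr t))

theorem endValue_eq (f : E × Bool → α) :
    endValue O (fun v a => f (O v a).1) (fun s => f (G.inputEnd s)) (fun t => f (G.outputEnd t))
      = f := by
  funext h
  obtain ⟨z, rfl⟩ := (edgeEndEquiv O).surjective h
  rw [endValue_edgeEndEquiv]
  rcases z with ⟨v, a⟩ | s | t <;> rfl

theorem prod_edge_ends [Fintype V] [Fintype S] [Fintype T] [Fintype E] (g : E × Bool → α → ℂ) :
    (∏ e, g (e, false) (endValue O p x y (e, false)) * g (e, true) (endValue O p x y (e, true))) =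
      (∏ v, ∏ a, g (O v a).1 (p v a)) *
        ((∏ s, g (G.inputEnd s) (x s)) * ∏ t, g (G.outputEnd t) (y t)) := by
  have h1 : (∏ e, g (e, false) (endValue O p x y (e, false)) *
      g (e, true) (endValue O p x y (e, true))) =
      ∏ h : E × Bool, g h (endValue O p x y h) := by
    rw [Fintype.prod_prod_type]
    refine Finset.prod_congr rfl fun e _ => ?_
    rw [Fintype.prod_bool, mul_comm]
  rw [h1, ← (edgeEndEquiv O).prod_comp, Fintype.prod_sum_type, Fintype.prod_sum_type,
    Fintype.prod_prod_type]
  simp only [endValue_edgeEndEquiv]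
  rfl

end endValue

/-! ### Contractions twisted by an involution. -/

/-- The assignments of values to the slots of all vertices such that the values at each vertex
satisfy `Q` and the values at the two ends of each edge are exchanged by `σ`. -/
def twistedConfigs {N : ℕ} (σ : Fin N → Fin N) (Q : (Fin d → Fin N) → Prop)
    (x : S → Fin N) (y : T → Fin N) : Set (V → Fin d → Fin N) :=
  {p | (∀ v, Q (p v)) ∧ ∀ e, endValue O p x y (e, true) = σ (endValue O p x y (e, false))}

/-- The ends of an edge are not distinguished by the tensor, so one matrix `M` must serve at both,
and `Mᵀ * M` must be the permutation matrix `P` of `σ`. As `P` is symmetric with `P ^ 2 = 1`, the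
matrix `(1 - i) / 2 + (1 + i) / 2 * P` is symmetric and squares to `P`. -/
theorem exists_symm_sq_eq_of_involutive {N : ℕ} {σ : Fin N → Fin N}
    (hσ : Function.Involutive σ) : ∃ M : Fin N → Fin N → ℂ, ∀ a b,
      ∑ m, M m a * M m b = if b = σ a then 1 else 0 := by
  refine ⟨fun m a => ((1 - Complex.I) / 2) * (if m = a then 1 else 0) +
    ((1 + Complex.I) / 2) * (if m = σ a then 1 else 0), fun a b => ?_⟩
  have hI := Complex.I_mul_I
  simp only [mul_add, add_mul, Finset.sum_add_distrib, mul_ite, ite_mul, mul_one, mul_zero,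
    zero_mul, Finset.sum_ite_eq', Finset.mem_univ, if_true]
  have h1 : (σ b = a) ↔ b = σ a := ⟨fun h => by rw [← h, hσ], fun h => by rw [h, hσ]⟩
  simp only [h1, hσ.injective.eq_iff]
  by_cases p : b = a <;> by_cases q : b = σ a
  · rw [if_pos p, if_pos p, if_pos q, if_pos q, if_pos q]
    ring
  · rw [if_pos p, if_pos p, if_neg q, if_neg q, if_neg q]
    linear_combination (1 / 2 : ℂ) * hI
  · rw [if_neg p, if_neg p, if_pos q, if_pos q, if_pos q]
    linear_combination (-1 / 2 : ℂ) * hI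
  · rw [if_neg p, if_neg p, if_neg q, if_neg q, if_neg q]
    ring

theorem rank_contraction_le_quantumMaxFlow [Fintype V] [Fintype S] [DecidableEq S] [Fintype E]
    {N : ℕ} (𝒯 : (Fin d → Fin N) → ℂ) :
    (G.contraction O 𝒯).rank ≤ G.quantumMaxFlow O N :=
  le_ciSup (f := fun 𝒯 : (Fin d → Fin N) → ℂ => (G.contraction O 𝒯).rank)
    ⟨Fintype.card (S → Fin N), by
      rintro _ ⟨𝒯, rfl⟩
      exact Matrix.rank_le_card_width _⟩ 𝒯

end OpenGraph

end TensorNet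

namespace TensorNet

namespace OpenGraph

variable {V S T E : Type*} {G : OpenGraph V S T E} {d : ℕ} (O : G.LocalOrdering d)

-- Apply `M` to every slot of the indicator of `Q`, and also to the open ends through `A` and `B`,
-- which cannot raise the rank. Summing over the index of an edge then leaves the condition that `σ`
-- exchanges its two end values, so the entries count twisted configurations.
open Classical in
theorem rank_twistedConfigs_le_quantumMaxFlow [Fintype V] [Fintype S] [Fintype T]
    [Fintype E] {N : ℕ} {σ : Fin N → Fin N} (hσ : Function.Involutive σ)
    (Q : (Fin d → Fin N) → Prop) :
    (Matrix.of fun (y : T → Fin N) (x : S → Fin N) =>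
      ((twistedConfigs O σ Q x y).ncard : ℂ)).rank ≤ G.quantumMaxFlow O N := by
  obtain ⟨M, hM⟩ := exists_symm_sq_eq_of_involutive hσ
  let 𝒯 : (Fin d → Fin N) → ℂ := fun q =>
    ∑ p : Fin d → Fin N, (∏ a, M (q a) (p a)) * (if Q p then 1 else 0)
  let A : Matrix (T → Fin N) (T → Fin N) ℂ := Matrix.of fun y' y => ∏ t, M (y t) (y' t)
  let B : Matrix (S → Fin N) (S → Fin N) ℂ := Matrix.of fun x x' => ∏ s, M (x s) (x' s)
  suffices h : (Matrix.of fun (y : T → Fin N) (x : S → Fin N) =>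
      ((twistedConfigs O σ Q x y).ncard : ℂ)) = A * G.contraction O 𝒯 * B by
    rw [h]
    refine le_trans (Matrix.rank_mul_le_left _ _) (le_trans (Matrix.rank_mul_le_right _ _) ?_)
    convert rank_contraction_le_quantumMaxFlow O 𝒯
  let U : Matrix (T → Fin N) (E → Fin N) ℂ := Matrix.of fun y i =>
    if (fun t => i (G.outputEnd t).1) = y then ∏ v, 𝒯 (fun a => i (O v a).1.1) else 0
  let D : Matrix (E → Fin N) (S → Fin N) ℂ := Matrix.of fun i x =>
    if (fun s => i (G.inputEnd s).1) = x then 1 else 0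
  have hUD : G.contraction O 𝒯 = U * D := by
    ext y x
    simp only [contraction, Matrix.of_apply, Matrix.mul_apply, U, D, Finset.sum_filter,
      compatible_iff, mul_ite, mul_one, mul_zero, ← ite_and]
    refine Finset.sum_congr rfl fun i _ => ?_
    simp only [and_comm]
  have hAU : ∀ y i, (A * U) y i =
      (∏ t, M (i (G.outputEnd t).1) (y t)) * ∏ v, 𝒯 (fun a => i (O v a).1.1) := by
    intro y i
    simp [Matrix.mul_apply, A, U]
  have hDB : ∀ i x, (D * B) i x = ∏ s, M (i (G.inputEnd s).1) (x s) := by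
    intro i x
    simp [Matrix.mul_apply, B, D]
  rw [hUD, ← Matrix.mul_assoc, Matrix.mul_assoc]
  ext y x
  rw [Matrix.mul_apply]
  simp only [hAU, hDB, Matrix.of_apply]
  have hT : ∀ i : E → Fin N, ∏ v, 𝒯 (fun a => i (O v a).1.1) =
      ∑ p : V → Fin d → Fin N, (∏ v, ∏ a, M (i (O v a).1.1) (p v a)) *
        (if ∀ v, Q (p v) then 1 else 0) := by
    intro i
    simp only [𝒯]
    rw [Finset.prod_univ_sum, Fintype.piFinset_univ]
    refine Finset.sum_congr rfl fun p _ => ?_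
    rw [Finset.prod_mul_distrib, Finset.prod_ite_zero]
    simp
  simp only [hT, Finset.mul_sum, Finset.sum_mul]
  rw [Finset.sum_comm]
  have hE : ∀ p : V → Fin d → Fin N,
      ∑ i : E → Fin N, (∏ v, ∏ a, M (i (O v a).1.1) (p v a)) *
        ((∏ s, M (i (G.inputEnd s).1) (x s)) * ∏ t, M (i (G.outputEnd t).1) (y t)) =
      if ∀ e, endValue O p x y (e, true) = σ (endValue O p x y (e, false)) then 1 else 0 := by
    intro p
    calc _ = ∑ i : E → Fin N, ∏ e, (M (i e) (endValue O p x y (e, false)) *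
        M (i e) (endValue O p x y (e, true))) :=
          Finset.sum_congr rfl fun i _ =>
            (prod_edge_ends O p x y fun h a => M (i h.1) a).symm
      _ = ∏ e, ∑ m, (M m (endValue O p x y (e, false)) * M m (endValue O p x y (e, true))) := by
          rw [Finset.prod_univ_sum, Fintype.piFinset_univ]
      _ = _ := by
          simp only [hM]
          rw [Finset.prod_ite_zero]
          simp
  have hcard : ((twistedConfigs O σ Q x y).ncard : ℂ) = ∑ p : V → Fin d → Fin N,
      (if ∀ v, Q (p v) then 1 else 0) *
      (if ∀ e, endValue O p x y (e, true) = σ (endValue O p x y (e, false)) then 1 else 0) := by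
    have : (twistedConfigs O σ Q x y) = ↑(Finset.univ.filter fun p : V → Fin d → Fin N =>
        (∀ v, Q (p v)) ∧ ∀ e, endValue O p x y (e, true) = σ (endValue O p x y (e, false))) := by
      ext p
      simp [twistedConfigs]
    rw [this, Set.ncard_coe_finset, Finset.card_filter]
    push_cast
    refine Finset.sum_congr rfl fun p _ => ?_
    simp only [ite_and, ite_mul, one_mul, zero_mul]
  rw [hcard]
  refine Finset.sum_congr rfl fun p _ => ?_
  rw [← hE, Finset.mul_sum]
  refine Finset.sum_congr rfl fun i _ => ?_
  ring

/-- If the twisted configurations with respect to a family of inputs and a family of outputs exist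
exactly on the diagonal, then the max-flow is at least the size of the families. -/
theorem card_le_quantumMaxFlow [Fintype V] [Fintype S] [DecidableEq S] [Fintype T] [Fintype E]
    {N : ℕ} {σ : Fin N → Fin N} (hσ : Function.Involutive σ) (Q : (Fin d → Fin N) → Prop)
    {κ : Type*} [Fintype κ] (x : κ → S → Fin N) (y : κ → T → Fin N)
    (h : ∀ k l, (twistedConfigs O σ Q (x l) (y k)).Nonempty ↔ k = l) :
    Fintype.card κ ≤ G.quantumMaxFlow O N := by
  classical
  have h1 := rank_twistedConfigs_le_quantumMaxFlow O hσ Q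
  have h2 := Matrix.rank_submatrix_le (Matrix.of fun (y : T → Fin N) (x : S → Fin N) =>
      ((twistedConfigs O σ Q x y).ncard : ℂ)) y x
  have hne : ∀ k l, ((twistedConfigs O σ Q (x l) (y k)).ncard : ℂ) ≠ 0 ↔ k = l := by
    intro k l
    rw [← h, Nat.cast_ne_zero, ← Nat.pos_iff_ne_zero, Set.ncard_pos]
  have h3 : ((Matrix.of fun (y : T → Fin N) (x : S → Fin N) =>
      ((twistedConfigs O σ Q x y).ncard : ℂ)).submatrix y x) = Matrix.diagonal fun k =>
      ((twistedConfigs O σ Q (x k) (y k)).ncard : ℂ) := by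
    ext k l
    rw [Matrix.diagonal_apply]
    split_ifs with hkl
    · rw [hkl]; rfl
    · exact not_not.1 fun hh => hkl ((hne k l).1 hh)
  rw [h3, Matrix.rank_diagonal] at h2
  have h4 : Fintype.card {k // ((twistedConfigs O σ Q (x k) (y k)).ncard : ℂ) ≠ 0} =
      Fintype.card κ :=
    Fintype.card_congr (Equiv.subtypeUnivEquiv fun k => (hne k k).2 rfl)
  rw [h4] at h2
  refine h2.trans (le_of_le_of_eq (le_of_eq_of_le ?_ h1) ?_) <;> congr!

end OpenGraph

end TensorNet

/-! ### Menger's theorem from Hall's theorem. -/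

namespace TensorNet

namespace OpenGraph

variable {V S T E : Type*} {G : OpenGraph V S T E} {d : ℕ} (O : G.LocalOrdering d)

theorem minCut_le [Fintype E] {A : Set (Node V S T)} (hA : IsCut A) :
    G.minCut ≤ (G.cutSet A).card :=
  ciInf_le (f := fun A : {A : Set (Node V S T) // IsCut A} => (G.cutSet A.1).card)
    (OrderBot.bddBelow _) ⟨A, hA⟩

variable (G) in
/-- Two edges are incident if some vertex is an end of both. -/
def Incident (e e' : E) : Prop :=
  ∃ v b b', G.ends e b = Node.vertex v ∧ G.ends e' b' = Node.vertex v

variable (G) in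
/-- The steps of a routing of `k` units of flow from the inputs to the outputs, which uses every
edge at most once; edges stepping to themselves are unused. -/
def RoutingStep {k : ℕ} : Fin k ⊕ E → E ⊕ Fin k → Prop
  | .inl _, .inl e => ∃ s, e = (G.inputEnd s).1
  | .inr e, .inl e' => e = e' ∨ G.Incident e e'
  | .inr e, .inr _ => ∃ t, e = (G.outputEnd t).1
  | .inl _, .inr _ => False

/-- The edge version of Menger's theorem. -/
theorem exists_routing [Fintype E] {k : ℕ} (hkG : k ≤ G.minCut) : ∃ f : Fin k ⊕ E → E ⊕ Fin k,
    Function.Injective f ∧ ∀ z, G.RoutingStep z (f z) := by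
  classical
  refine (Fintype.all_card_le_filter_rel_iff_exists_injective _).1 fun X => ?_
  set Y : Finset E := X.toRight
  have hX : X.card = X.toLeft.card + Y.card := (Finset.card_toLeft_add_card_toRight).symm
  have hk : X.toLeft.card ≤ k := by
    simpa using Finset.card_le_univ X.toLeft
  set W : Finset (E ⊕ Fin k) := {w | ∃ z ∈ X, G.RoutingStep z w} with hW
  change X.card ≤ W.card
  have hWc : W.card = W.toLeft.card + W.toRight.card :=
    (Finset.card_toLeft_add_card_toRight).symm
  have hYW : Y ⊆ W.toLeft := fun e he => by
    rw [Finset.mem_toLeft, hW, Finset.mem_filter]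
    exact ⟨Finset.mem_univ _, Sum.inr e, Finset.mem_toRight.1 he, Or.inl rfl⟩
  by_cases hT : ∃ t, (G.outputEnd t).1 ∈ Y
  · obtain ⟨t, ht⟩ := hT
    have : W.toRight = Finset.univ := by
      refine Finset.eq_univ_of_forall fun j => ?_
      rw [Finset.mem_toRight, hW, Finset.mem_filter]
      exact ⟨Finset.mem_univ _, Sum.inr _, Finset.mem_toRight.1 ht, t, rfl⟩
    have h1 : W.toRight.card = k := by rw [this]; simp
    have h2 := Finset.card_le_card hYW
    omega
  rcases X.toLeft.eq_empty_or_nonempty with h0 | ⟨i, hi⟩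
  · have h2 := Finset.card_le_card hYW
    rw [hX, h0, Finset.card_empty]
    omega
  -- In the remaining case of Hall's condition, take the cut around the inputs and the vertices
  -- touched by `Y`. Its cut edges are reachable in one step but not in `Y`, so `W` has at least
  -- `MC(G)` elements beyond `Y`.
  let A : Set (Node V S T) := {z | (∃ s, z = Node.input s) ∨
    ∃ v, z = Node.vertex v ∧ ∃ e ∈ Y, ∃ b, G.ends e b = Node.vertex v}
  have hA : IsCut A := ⟨fun s => Or.inl ⟨s, rfl⟩, fun t h => by
    rcases h with ⟨s, hs⟩ | ⟨v, hv, -⟩ <;> contradiction⟩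
  have hYA : ∀ e ∈ Y, ∀ b, G.ends e b ∈ A := by
    intro e he b
    rcases h : G.ends e b with v | s | t
    · exact Or.inr ⟨v, rfl, e, he, b, h⟩
    · exact Or.inl ⟨s, rfl⟩
    · exact absurd ⟨t, by rwa [← G.eq_outputEnd h]⟩ hT
  have hcut : G.cutSet A ⊆ W.toLeft \ Y := by
    intro e he
    simp only [cutSet, Finset.mem_filter, Finset.mem_univ, true_and] at he
    obtain ⟨b, hb, hb'⟩ := he
    rw [Finset.mem_sdiff]
    refine ⟨?_, fun h => hb' (hYA e h _)⟩
    rw [Finset.mem_toLeft, hW, Finset.mem_filter]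
    refine ⟨Finset.mem_univ _, ?_⟩
    rcases hb with ⟨s, hs⟩ | ⟨v, hv, e', he', b', hb'⟩
    · exact ⟨Sum.inl i, Finset.mem_toLeft.1 hi, s, by rw [← G.eq_inputEnd hs]⟩
    · exact ⟨Sum.inr e', Finset.mem_toRight.1 he', Or.inr ⟨v, b', b, hb', hv⟩⟩
  have h1 := (minCut_le (G := G) hA).trans (Finset.card_le_card hcut)
  rw [Finset.card_sdiff_of_subset hYW] at h1
  have h2 := Finset.card_le_card hYW
  omega

/-! ### Routes traced by an injection. -/

/-- The step relation between edges of a partial injection. -/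
def NextEdge {k : ℕ} (f : Fin k ⊕ E → E ⊕ Fin k) (e e' : E) : Prop := f (Sum.inr e) = Sum.inl e'

open Relation

section routes

variable {k : ℕ} {f : Fin k ⊕ E → E ⊕ Fin k} (hf : Function.Injective f)
include hf

theorem start_unique {i j : Fin k} {a b e : E} (hi : f (Sum.inl i) = Sum.inl a)
    (hj : f (Sum.inl j) = Sum.inl b) (ha : ReflTransGen (NextEdge f) a e)
    (hb : ReflTransGen (NextEdge f) b e) : i = j := by
  have hno : ∀ {i : Fin k} {a c : E}, f (Sum.inl i) = Sum.inl a → ¬ NextEdge f c a :=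
    fun h h' => Sum.inl_ne_inr (hf (h.trans h'.symm))
  induction ha with
  | refl =>
    cases hb with
    | refl => exact Sum.inl_injective (hf (hi.trans hj.symm))
    | tail _ h => exact absurd h (hno hi)
  | tail _ h ih =>
    cases hb with
    | refl => exact absurd h (hno hj)
    | tail h1 h2 =>
      have := Sum.inr_injective (hf (h.trans h2.symm))
      exact ih (this ▸ h1)

theorem exists_route_end [Finite E] {i : Fin k} {a : E} (hi : f (Sum.inl i) = Sum.inl a) :
    ∃ e j, ReflTransGen (NextEdge f) a e ∧ f (Sum.inr e) = Sum.inr j := by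
  by_contra! hcon
  let D := {e // ReflTransGen (NextEdge f) a e}
  have hg : ∀ e : D, ∃ e' : D, NextEdge f e.1 e'.1 := by
    rintro ⟨e, he⟩
    rcases h : f (Sum.inr e) with e' | j
    · exact ⟨⟨e', he.tail h⟩, h⟩
    · exact absurd h (hcon e j he)
  choose g hg using hg
  have hinj : Function.Injective g := by
    intro e e' h
    have h1 := hg e
    rw [h] at h1
    exact Subtype.ext (Sum.inr_injective (hf (h1.trans (hg e').symm)))
  -- A route that never ends would permute the finite set of edges it reaches, so some edge would
  -- step to `a`, which is already the image of `Sum.inl i`.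
  obtain ⟨e, he⟩ := Finite.surjective_of_injective hinj ⟨a, .refl⟩
  have h1 := hg e
  rw [he] at h1
  exact Sum.inl_ne_inr (hf (hi.trans h1.symm))

/-- Routes with different starts are disjoint, so their labels can be prescribed independently. All
edges off the routes share one arbitrary label, which keeps labels constant along steps there too.
-/
theorem exists_labelling {n : Type*} [Nonempty n] {a : Fin k → E}
    (ha : ∀ i, f (Sum.inl i) = Sum.inl (a i)) (κ : Fin k → n) :
    ∃ l : E → n, (∀ e e', NextEdge f e e' → l e = l e') ∧
      ∀ i e, ReflTransGen (NextEdge f) (a i) e → l e = κ i := by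
  classical
  let l : E → n := fun e => if h : ∃ i, ReflTransGen (NextEdge f) (a i) e then κ h.choose else
    Classical.arbitrary n
  have h1 : ∀ i e, ReflTransGen (NextEdge f) (a i) e → l e = κ i := by
    intro i e h
    have hex : ∃ i, ReflTransGen (NextEdge f) (a i) e := ⟨i, h⟩
    simp only [l, dif_pos hex]
    rw [start_unique hf (ha _) (ha i) hex.choose_spec h]
  refine ⟨l, fun e e' h => ?_, h1⟩
  by_cases hex : ∃ i, ReflTransGen (NextEdge f) (a i) e'
  · obtain ⟨i, hi⟩ := hex
    rw [h1 i e' hi]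
    cases hi with
    | refl => exact absurd (hf ((ha i).trans h.symm)) Sum.inl_ne_inr
    | tail h2 h3 => exact h1 i e (Sum.inr_injective (hf (h.trans h3.symm)) ▸ h2)
  · have hex' : ¬ ∃ i, ReflTransGen (NextEdge f) (a i) e := fun ⟨i, hi⟩ => hex ⟨i, hi.tail h⟩
    simp only [l, dif_neg hex, dif_neg hex']

end routes

/-! ### The lower bound by routing labels. -/

/-- Any involution of a finite type extends along an embedding. -/
theorem exists_involutive_extension {α β : Type*} (ι : α ↪ β) {τ : α → α}
    (hτ : Function.Involutive τ) :
    ∃ σ : β → β, Function.Involutive σ ∧ ∀ a, σ (ι a) = ι (τ a) := by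
  have h1 : ∀ a, Function.extend ι (ι ∘ τ) id (ι a) = ι (τ a) := fun a =>
    ι.injective.extend_apply _ _ a
  refine ⟨Function.extend ι (ι ∘ τ) id, fun b => ?_, h1⟩
  by_cases hb : ∃ a, ι a = b
  · obtain ⟨a, rfl⟩ := hb
    rw [h1, h1, hτ]
  · rw [Function.extend_apply' _ _ _ hb, id, Function.extend_apply' _ _ _ hb, id]

theorem pow_minCut_le_quantumMaxFlow [Fintype V] [Fintype S] [DecidableEq S] [Fintype T]
    [Fintype E] {n N : ℕ} (hn : 0 < n) (hN : 2 * Fintype.card E * n ≤ N) :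
    n ^ G.minCut ≤ G.quantumMaxFlow O N := by
  classical
  obtain ⟨f, hf, hstep⟩ := exists_routing (G := G) le_rfl
  obtain ⟨ι⟩ : Nonempty ((E × Bool) × Fin n ↪ Fin N) := by
    refine Function.Embedding.nonempty_of_card_le ?_
    simpa [mul_comm] using hN
  obtain ⟨σ, hσ, hσι⟩ := exists_involutive_extension ι
    (τ := fun z => ((z.1.1, !z.1.2), z.2)) (fun z => by simp)
  have ha : ∀ i, ∃ e, f (Sum.inl i) = Sum.inl e ∧ ∃ s, e = (G.inputEnd s).1 := by
    intro i
    have := hstep (Sum.inl i)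
    rcases h : f (Sum.inl i) with e | j
    · rw [h] at this
      exact ⟨e, rfl, this⟩
    · rw [h] at this
      exact this.elim
  choose a ha hs using ha
  have : Nonempty (Fin n) := ⟨⟨0, hn⟩⟩
  choose l hl hla using exists_labelling (n := Fin n) hf ha
  -- The vertex is quantified existentially because `Q` may not depend on where the tensor is
  -- placed.
  let Q : (Fin d → Fin N) → Prop := fun p => ∃ (v : V) (k : Fin d → Fin n),
    (∀ c, p c = ι ((O v c).1, k c)) ∧
      ∀ c c', NextEdge f (O v c).1.1 (O v c').1.1 → k c = k c'
  have main := card_le_quantumMaxFlow O hσ Q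
    (fun (κ : Fin G.minCut → Fin n) s => ι (G.inputEnd s, l κ (G.inputEnd s).1))
    (fun κ t => ι (G.outputEnd t, l κ (G.outputEnd t).1))
  rw [Fintype.card_fun, Fintype.card_fin, Fintype.card_fin] at main
  refine main fun κ' κ => ⟨?_, ?_⟩
  swap
  · rintro rfl
    refine ⟨fun v c => ι ((O v c).1, l κ' (O v c).1.1), fun v => ⟨v, _, fun _ => rfl,
      fun c c' h => hl _ _ _ h⟩, fun e => ?_⟩
    rw [endValue_eq O (fun h => ι (h, l κ' h.1)), hσι]
    rfl
  rintro ⟨p, hp, htw⟩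
  let j := endValue O p (fun s => ι (G.inputEnd s, l κ (G.inputEnd s).1))
    (fun t => ι (G.outputEnd t, l κ' (G.outputEnd t).1))
  have htw' : ∀ e b m, j (e, b) = ι ((e, b), m) → ∀ b', j (e, b') = ι ((e, b'), m) := by
    intro e b m h b'
    have h1 : j (e, true) = σ (j (e, false)) := htw e
    have h2 : j (e, false) = σ (j (e, true)) := by rw [h1, hσ]
    cases b <;> cases b' <;> first | exact h | skip
    · rw [h1, h, hσι]; rfl
    · rw [h2, h, hσι]; rfl
  have hroute : ∀ i e, ReflTransGen (NextEdge f) (a i) e → ∀ b, j (e, b) = ι ((e, b), κ i) := by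
    intro i e he
    induction he with
    | refl =>
      obtain ⟨s, hs⟩ := hs i
      refine htw' _ (G.inputEnd s).2 _ ?_
      have h1 : j (G.inputEnd s) = _ := endValue_inputEnd O _ _ _ s
      rw [hs, Prod.mk.eta, h1, hla κ i _ (hs ▸ .refl)]
    | @tail e e' _ h ih =>
      have h1 := hstep (Sum.inr e)
      rw [NextEdge] at h
      rw [h] at h1
      rcases h1 with rfl | ⟨v, b, b', hb, hb'⟩
      · exact ih
      obtain ⟨c, hc⟩ := (O v).surjective ⟨(e, b), hb⟩
      obtain ⟨c', hc'⟩ := (O v).surjective ⟨(e', b'), hb'⟩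
      obtain ⟨w, m, hpm, hm⟩ := hp v
      have h2 : j (e, b) = p v c := by
        have := endValue_vertex O p (fun s => ι (G.inputEnd s, l κ (G.inputEnd s).1))
          (fun t => ι (G.outputEnd t, l κ' (G.outputEnd t).1)) v c
        rwa [hc] at this
      have h3 : j (e', b') = p v c' := by
        have := endValue_vertex O p (fun s => ι (G.inputEnd s, l κ (G.inputEnd s).1))
          (fun t => ι (G.outputEnd t, l κ' (G.outputEnd t).1)) v c'
        rwa [hc'] at this
      rw [ih b, hpm c] at h2
      have h4 := ι.injective h2
      rw [Prod.mk.injEq] at h4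
      obtain ⟨h4, h5⟩ := h4
      -- The incoming value names an edge end attached to `v`, so the role `w` played at `v` must be
      -- `v` itself.
      have hvw : v = w := by
        have := (O w c).2
        rw [← h4, hb] at this
        exact Node.vertex.inj this
      subst hvw
      refine htw' _ b' _ ?_
      rw [h3, hpm c', hc', h5, hm c c' (by rw [hc, hc']; exact h)]
  funext i
  obtain ⟨e, m, he, hm⟩ := exists_route_end hf (ha i)
  have h1 := hstep (Sum.inr e)
  rw [hm] at h1
  obtain ⟨t, ht⟩ := h1
  have h2 := hroute i e he (G.outputEnd t).2
  have h3 : j (G.outputEnd t) = _ := endValue_outputEnd O _ _ _ t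
  rw [ht, Prod.mk.eta, h3] at h2
  have h4 := (Prod.mk.inj (ι.injective h2)).2
  rwa [← ht, hla κ' i e he] at h4

end OpenGraph

end TensorNet

/-! ### The upper bound by cuts. -/

namespace TensorNet

open Classical in
/-- A sum over assignments of products of a function of the values in `I` and a function of the
values in `J` has rank at most the number of assignments of values in `I ∩ J`. -/
theorem rank_sum_mul_le {E m n : Type*} [Fintype E] [Fintype n] {N : ℕ} [NeZero N]
    (I J : E → Prop) (C : Finset E) (hC : ∀ e, I e → J e → e ∈ C)
    (u : (E → Fin N) → m → ℂ) (w : (E → Fin N) → n → ℂ)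
    (hu : ∀ i i', (∀ e, J e → i e = i' e) → u i = u i')
    (hw : ∀ i i', (∀ e, I e → i e = i' e) → w i = w i') :
    (Matrix.of fun y x => ∑ i, u i y * w i x).rank ≤ N ^ C.card := by
  let φ := Equiv.piEquivPiSubtypeProd I (fun _ => Fin N)
  have hφ : ∀ p q e, φ.symm (p, q) e = if h : I e then p ⟨e, h⟩ else q ⟨e, h⟩ := fun _ _ _ => rfl
  -- The factor `u` sees the `I`-part `p` only through its restriction `r p` to `C`, and `w` does
  -- not see the rest `q`; the value `0` fills coordinates that do not matter.
  let r : ({e // I e} → Fin N) → C → Fin N := fun p c => φ.symm (p, 0) c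
  let ext : (C → Fin N) → {e // I e} → Fin N := fun z e =>
    if h : e.1 ∈ C then z ⟨e.1, h⟩ else 0
  let U : Matrix m (C → Fin N) ℂ := Matrix.of fun y z => ∑ q, u (φ.symm (ext z, q)) y
  let W : Matrix (C → Fin N) n ℂ := Matrix.of fun z x =>
    ∑ p with r p = z, w (φ.symm (p, 0)) x
  have hUW : (Matrix.of fun y x => ∑ i, u i y * w i x) = U * W := by
    ext y x
    simp only [Matrix.mul_apply, Matrix.of_apply, U, W]
    calc ∑ i, u i y * w i x
        = ∑ p, ∑ q, u (φ.symm (p, q)) y * w (φ.symm (p, q)) x := by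
          rw [← φ.symm.sum_comp, Fintype.sum_prod_type]
      _ = ∑ p, (∑ q, u (φ.symm (ext (r p), q)) y) * w (φ.symm (p, 0)) x := by
          refine Finset.sum_congr rfl fun p _ => ?_
          rw [Finset.sum_mul]
          refine Finset.sum_congr rfl fun q _ => ?_
          refine congrArg₂ (· * ·) ?_ ?_
          · refine congrFun (hu _ _ fun e he => ?_) y
            rw [hφ, hφ]
            split_ifs with h
            · simp [ext, r, hφ, h, hC e h he]
            · rfl
          · refine congrFun (hw _ _ fun e he => ?_) x
            rw [hφ, hφ, dif_pos he, dif_pos he]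
      _ = _ := by
          rw [← Finset.sum_fiberwise Finset.univ r]
          refine Finset.sum_congr rfl fun z _ => ?_
          rw [Finset.mul_sum]
          refine Finset.sum_congr rfl fun p hp => ?_
          rw [(Finset.mem_filter.1 hp).2]
  rw [hUW]
  refine (Matrix.rank_mul_le_left _ _).trans ((Matrix.rank_le_card_width _).trans ?_)
  simp

namespace OpenGraph

variable {V S T E : Type*} {G : OpenGraph V S T E} {d : ℕ} (O : G.LocalOrdering d)

theorem rank_contraction_le_of_isCut [Fintype V] [Fintype S] [DecidableEq S] [Fintype E]
    {N : ℕ} (hN : 1 ≤ N) (𝒯 : (Fin d → Fin N) → ℂ) {A : Set (Node V S T)} (hA : IsCut A) :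
    (G.contraction O 𝒯).rank ≤ N ^ (G.cutSet A).card := by
  classical
  have : NeZero N := ⟨by omega⟩
  have h := rank_sum_mul_le (N := N) (fun e => ∃ b, G.ends e b ∈ A) (fun e => ∃ b, G.ends e b ∉ A)
    (G.cutSet A) (m := T → Fin N) (n := S → Fin N)
    (by
      rintro e ⟨b, hb⟩ ⟨b', hb'⟩
      have : b' = !b := by
        have hne : b' ≠ b := by
          rintro rfl
          exact hb' hb
        exact Bool.eq_not.2 hne
      subst this
      simp only [cutSet, Finset.mem_filter, Finset.mem_univ, true_and]
      exact ⟨b, hb, hb'⟩)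
    -- Outputs and vertices outside `A` go into the first factor, inputs and vertices inside `A`
    -- into the second.
    (fun i y => (if (fun t => i (G.outputEnd t).1) = y then 1 else 0) *
      ∏ v, if Node.vertex v ∈ A then 1 else 𝒯 (fun a => i (O v a).1.1))
    (fun i x => (if (fun s => i (G.inputEnd s).1) = x then 1 else 0) *
      ∏ v, if Node.vertex v ∈ A then 𝒯 (fun a => i (O v a).1.1) else 1)
    (by
      intro i i' hi
      have h1 : ∀ t, i (G.outputEnd t).1 = i' (G.outputEnd t).1 := fun t =>
        hi _ ⟨(G.outputEnd t).2, by rw [G.ends_outputEnd]; exact hA.2 t⟩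
      funext y
      simp only [h1]
      congr 1
      refine Finset.prod_congr rfl fun v _ => ?_
      split_ifs with hv
      · rfl
      · congr 1
        funext a
        exact hi _ ⟨(O v a).1.2, by rw [(O v a).2]; exact hv⟩)
    (by
      intro i i' hi
      have h1 : ∀ s, i (G.inputEnd s).1 = i' (G.inputEnd s).1 := fun s =>
        hi _ ⟨(G.inputEnd s).2, by rw [G.ends_inputEnd]; exact hA.1 s⟩
      funext y
      simp only [h1]
      congr 1
      refine Finset.prod_congr rfl fun v _ => ?_
      split_ifs with hv
      · congr 1
        funext a
        exact hi _ ⟨(O v a).1.2, by rw [(O v a).2]; exact hv⟩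
      · rfl)
  convert h using 2
  ext y x
  simp only [contraction, Matrix.of_apply, Finset.sum_filter, compatible_iff]
  refine Finset.sum_congr rfl fun i _ => ?_
  rw [mul_mul_mul_comm, ← Finset.prod_mul_distrib]
  have : ∀ v, ((if Node.vertex v ∈ A then 1 else 𝒯 (fun a => i (O v a).1.1)) *
      if Node.vertex v ∈ A then 𝒯 (fun a => i (O v a).1.1) else 1) =
      𝒯 (fun a => i (O v a).1.1) := by
    intro v
    split_ifs <;> simp
  simp only [this, ite_and, ite_mul, mul_ite, one_mul, mul_one, zero_mul, mul_zero]
  split_ifs <;> rfl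

variable (G) in
theorem exists_minCut [Fintype E] :
    ∃ A : Set (Node V S T), IsCut A ∧ (G.cutSet A).card = G.minCut := by
  have : Nonempty {A : Set (Node V S T) // IsCut A} :=
    ⟨⟨{z | ∃ s, z = Node.input s}, fun s => ⟨s, rfl⟩, fun t ⟨s, h⟩ => by contradiction⟩⟩
  obtain ⟨A, hA⟩ := Nat.sInf_mem
    (Set.range_nonempty fun A : {A : Set (Node V S T) // IsCut A} => (G.cutSet A.1).card)
  exact ⟨A.1, A.2, hA⟩

variable (G) in
theorem quantumMinCut_eq [Fintype E] {N : ℕ} (hN : 1 ≤ N) :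
    G.quantumMinCut N = N ^ G.minCut := by
  obtain ⟨A, hA, hc⟩ := G.exists_minCut
  have : Nonempty {A : Set (Node V S T) // IsCut A} := ⟨⟨A, hA⟩⟩
  simp only [quantumMinCut, Finset.prod_const]
  refine le_antisymm ?_ (le_ciInf fun A => Nat.pow_le_pow_right hN (minCut_le A.2))
  rw [← hc]
  exact ciInf_le (f := fun A : {A : Set (Node V S T) // IsCut A} => N ^ (G.cutSet A.1).card)
    (OrderBot.bddBelow _) ⟨A, hA⟩

theorem quantumMaxFlow_le [Fintype V] [Fintype S] [DecidableEq S] [Fintype E] {N : ℕ}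
    (hN : 1 ≤ N) : G.quantumMaxFlow O N ≤ N ^ G.minCut := by
  obtain ⟨A, hA, hc⟩ := G.exists_minCut
  rw [← hc]
  exact ciSup_le fun 𝒯 => rank_contraction_le_of_isCut O hN 𝒯 hA

/-! ### The constant. -/

theorem one_le_quantumMaxFlow [Fintype V] [Fintype S] [DecidableEq S] [Fintype E] {N : ℕ}
    (hN : 1 ≤ N) : 1 ≤ G.quantumMaxFlow O N := by
  classical
  -- For the all-ones tensor each entry counts compatible assignments; the entry at constant `x` and
  -- `y` is nonzero.
  refine le_trans ?_ (rank_contraction_le_quantumMaxFlow O fun _ => 1)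
  rw [Nat.one_le_iff_ne_zero]
  intro h
  rw [Matrix.rank, Submodule.finrank_eq_zero, LinearMap.range_eq_bot] at h
  have h1 := congrFun (DFunLike.congr_fun h (Pi.single (fun _ => ⟨0, hN⟩) 1)) fun _ => ⟨0, hN⟩
  rw [Matrix.mulVecLin_apply, Matrix.mulVec_single_one, LinearMap.zero_apply] at h1
  simp only [Matrix.col_apply, Pi.zero_apply, contraction, Matrix.of_apply, Finset.prod_const_one, Finset.sum_const, nsmul_eq_mul,
    mul_one, Nat.cast_eq_zero, Finset.card_eq_zero] at h1
  refine Finset.notMem_empty (fun _ => ⟨0, hN⟩ : E → Fin N) (h1 ▸ ?_)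
  simp [compatible_iff]

theorem mul_pow_minCut_le_quantumMaxFlow [Fintype V] [Fintype S] [DecidableEq S] [Fintype T]
    [Fintype E] {N : ℕ} (hN : 1 ≤ N) :
    (1 / (2 * (2 * Fintype.card E + 1) : ℝ)) ^ G.minCut * (N : ℝ) ^ G.minCut ≤
      G.quantumMaxFlow O N := by
  -- The `+ 1` keeps `K` positive when there are no edges. With `n = N / K` rounded down, `n ≥ 1`
  -- gives `N < K * (n + 1) ≤ 2 * K * n`; if `n = 0`, then `N < K` and the bound `1` suffices.
  set K := 2 * Fintype.card E + 1 with hK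
  have hKr : (2 * Fintype.card E + 1 : ℝ) = K := by rw [hK]; push_cast; ring
  rw [hKr, ← mul_pow]
  have hK0 : (0 : ℝ) < K := by rw [hK]; positivity
  have hlt : N < K * (N / K + 1) := Nat.lt_mul_div_succ N (by omega)
  have hle : K * (N / K) ≤ N := Nat.mul_div_le N K
  rcases Nat.eq_zero_or_pos (N / K) with h0 | hpos
  · rw [h0, zero_add, mul_one] at hlt
    have h1 : (1 : ℝ) ≤ G.quantumMaxFlow O N := by exact_mod_cast one_le_quantumMaxFlow O hN
    refine le_trans (pow_le_one₀ (by positivity) ?_) h1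
    have : (N : ℝ) ≤ K := by exact_mod_cast hlt.le
    rw [one_div, inv_mul_le_iff₀ (by positivity)]
    linarith
  · have h1 := pow_minCut_le_quantumMaxFlow O (N := N) hpos
      (le_trans (Nat.mul_le_mul_right _ (by omega)) hle)
    have h1r : ((N / K : ℕ) : ℝ) ^ G.minCut ≤ G.quantumMaxFlow O N := by exact_mod_cast h1
    refine le_trans (pow_le_pow_left₀ (by positivity) ?_ _) h1r
    have h2 : (N : ℝ) ≤ K * ((N / K : ℕ) + 1) := by exact_mod_cast hlt.le
    have h3 : (1 : ℝ) ≤ (N / K : ℕ) := by exact_mod_cast hpos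
    rw [one_div, inv_mul_le_iff₀ (by positivity)]
    nlinarith

end OpenGraph

end TensorNet

theorem theorem2 {V S T E : Type*} [Fintype V] [Fintype S] [DecidableEq S] [Fintype T]
    [Fintype E] (G : TensorNet.OpenGraph V S T E) (d : ℕ) :
    (∀ O : G.LocalOrdering d,
      (fun N : ℕ => (G.quantumMaxFlow O N : ℝ)) =Θ[Filter.atTop]
        (fun N : ℕ => (G.quantumMinCut N : ℝ))) ∧
    (∃ c : ℝ, 0 < c ∧ ∀ (O : G.LocalOrdering d) (N : ℕ), 1 ≤ N →
      c * (N : ℝ) ^ G.minCut ≤ (G.quantumMaxFlow O N : ℝ)) := by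
  have hc : (0 : ℝ) < (1 / (2 * (2 * Fintype.card E + 1) : ℝ)) ^ G.minCut := by positivity
  have hlow := fun (O : G.LocalOrdering d) (N : ℕ) (hN : 1 ≤ N) =>
    TensorNet.OpenGraph.mul_pow_minCut_le_quantumMaxFlow O hN
  refine ⟨fun O => ⟨?_, ?_⟩, _, hc, hlow⟩
  · refine Asymptotics.IsBigO.of_bound 1 ?_
    filter_upwards [Filter.eventually_ge_atTop 1] with N hN
    rw [Real.norm_natCast, Real.norm_natCast, one_mul, G.quantumMinCut_eq hN]
    exact_mod_cast TensorNet.OpenGraph.quantumMaxFlow_le O hN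
  · refine Asymptotics.IsBigO.of_bound
      ((1 / (2 * (2 * Fintype.card E + 1) : ℝ)) ^ G.minCut)⁻¹ ?_
    filter_upwards [Filter.eventually_ge_atTop 1] with N hN
    rw [Real.norm_natCast, Real.norm_natCast, G.quantumMinCut_eq hN, le_inv_mul_iff₀ hc]
    exact_mod_cast hlow O N hN
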